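/- Let $0<\beta<1$, let $0=t_0<t_1<\cdots<t_N$ be a mesh with step sizes $\tau_k:=t_k-t_{k-1}$ $(1\le k\le N)$ and step ratios $r_k:=\tau_k/\tau_{k-1}$ $(2\le k\le N)$. Put $\omega_\beta(t):=t^{\beta-1}/\Gamma(\beta)$, $\rho(z):=(z+1)^{1+\beta}-z^{1+\beta}-1$ and $$r_*(z):=\left[\frac{(2^\beta-1)\rho(z)}{\rho(2z)-\rho(z)}\right]^{\frac1{1-\beta}}\qquad(z>0).$$ For $1\le k\le n\le N$ let $$a^{(\beta,n)}_{n-k}:=\frac1{\tau_n\tau_k}\int_{t_{n-1}}^{t_n}\int_{t_{k-1}}^{\min\{t,t_k\}}\omega_\beta(t-s)\,\mathrm ds\,\mathrm dt$$ be the Crank–Nicolson (integral averaged, L1$^+$) kernels of the Riemann–Liouville integral of order $\beta$, and let $\mathsf a^{(\beta,n)}_0:=2a^{(\beta,n)}_0$ and $\mathsf a^{(\beta,n)}_{n-k}:=a^{(\beta,n)}_{n-k}$ $(1\le k\le n-1)$ be the modified kernels. Define $\theta^{(n)}_0:=1/\mathsf a^{(\beta,n)}_0$ and, for $k=n-1,\dots,1$,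 $$\theta^{(n)}_{n-k}:=-\frac1{\mathsf a^{(\beta,k)}_0}\sum_{j=k+1}^n\theta^{(n)}_{n-j}\,\mathsf a^{(\beta,j)}_{j-k},$$ and, for $1\le k\le n$, the left- and right-complementary kernels $$\mathsf p^{(n)}_{n-k}:=\sum_{j=k}^n\theta^{(j)}_{j-k},\qquad \mathsf q^{(n)}_{n-k}:=\sum_{j=k}^n\theta^{(n)}_{n-j}.$$ Suppose that $r_{k+1}\ge r_*(r_k)$ for $2\le k\le N-1$. Then: (i) $\mathsf p^{(n)}_{n-k}>0$ and $\mathsf q^{(n)}_{n-k}>0$ for $1\le k\le n\le N$. (ii) For every real sequence $(w_k)$, with $v_0:=0$ and $v_j:=\sum_{\ell=1}^j\mathsf a^{(\beta,j)}_{j-\ell}w_\ell$, and every $1\le n\le N$, $$2w_n\sum_{j=1}^na^{(\beta,n)}_{n-j}w_j=\sum_{j=1}^n\mathsf p^{(n)}_{n-j}v_j^2-\sum_{j=1}^{n-1}\mathsf p^{(n-1)}_{n-1-j}v_j^2+\sum_{j=1}^{n-1}\left(\frac1{\mathsf q^{(n)}_{n-j}}-\frac1{\mathsf q^{(n)}_{n-j-1}}\right)\left(\sum_{k=1}^j\mathsf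 q^{(n)}_{n-k}(v_k-v_{k-1})\right)^2.$$ (iii) The kernels $a^{(\beta,n)}_{n-k}$ are positive definite: for every $1\le n\le N$ and every real sequence with $(w_1,\dots,w_n)\ne0$, $$2\sum_{k=1}^nw_k\sum_{j=1}^ka^{(\beta,k)}_{k-j}w_j\ \ge\ \sum_{k=1}^n\mathsf p^{(n)}_{n-k}v_k^2\ >\ 0.$$ -/

import Mathlib

noncomputable section

open Finset

namespace IAF

/-- The weakly singular kernel `ω_β(x) = x^(β-1) / Γ(β)`. -/
def omega (β x : ℝ) : ℝ := x ^ (β - 1) / Real.Gamma β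

/-- The step size `τ_k = t_k - t_{k-1}`, for `k ≥ 1`. -/
def step (t : ℕ → ℝ) (k : ℕ) : ℝ := t k - t (k - 1)

/-- The step ratio `r_k = τ_k / τ_{k-1}`, for `k ≥ 2`. -/
def ratio (t : ℕ → ℝ) (k : ℕ) : ℝ := step t k / step t (k - 1)

/-- `ρ(z) = (z+1)^(1+β) - z^(1+β) - 1`. -/
def rho (β z : ℝ) : ℝ := (z + 1) ^ (1 + β) - z ^ (1 + β) - 1

/-- `r_*(z) = [ (2^β - 1) ρ(z) / (ρ(2z) - ρ(z)) ]^(1/(1-β))`. -/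
def rStar (β z : ℝ) : ℝ :=
  (((2 : ℝ) ^ β - 1) * rho β z / (rho β (2 * z) - rho β z)) ^ (1 / (1 - β))

/-!
A family of discrete convolution kernels `a^{(n)}_{n-k}`, `1 ≤ k ≤ n`, is written as a function
`a : ℕ → ℕ → ℝ` with `a n k` standing for `a^{(n)}_{n-k}`: the first argument is the superscript
`n`, the second is `k`, so that `a n n` is `a^{(n)}_0` and `a j k` is `a^{(j)}_{j-k}`.
-/

/-- The kernels `a^{(β,n)}_{n-k}` of the integral averaged formula on the mesh `t`. -/
def kernel (β : ℝ) (t : ℕ → ℝ) (n k : ℕ) : ℝ :=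
  1 / (step t n * step t k) *
    ∫ x in (t (n - 1))..(t n), ∫ s in (t (k - 1))..(min x (t k)), omega β (x - s)

/-- The modified kernels: the kernel with subscript `0` is doubled, the others are kept. -/
def modified (a : ℕ → ℕ → ℝ) (n k : ℕ) : ℝ := if k = n then 2 * a n n else a n k

/-- The discrete orthogonal convolution (DOC) kernels: `doc a n k` is `θ^{(n)}_{n-k}`, where
`θ^{(n)}_0 = 1 / a^{(n)}_0` and
`θ^{(n)}_{n-k} = -(1 / a^{(k)}_0) ∑_{j=k+1}^n θ^{(n)}_{n-j} a^{(j)}_{j-k}` for `1 ≤ k ≤ n-1`. -/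
def doc (a : ℕ → ℕ → ℝ) (n k : ℕ) : ℝ :=
  if k = n then 1 / a n n
  else -(1 / a k k) * ∑ j ∈ (Icc (k + 1) n).attach, doc a n j.1 * a j.1 k
termination_by n - k
decreasing_by
  have h := Finset.mem_Icc.mp j.2
  omega

theorem doc_self (a : ℕ → ℕ → ℝ) (n : ℕ) : doc a n n = 1 / a n n := by
  rw [doc, if_pos rfl]

theorem doc_of_lt (a : ℕ → ℕ → ℝ) {n k : ℕ} (h : k < n) :
    doc a n k = -(1 / a k k) * ∑ j ∈ Icc (k + 1) n, doc a n j * a j k := by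
  rw [doc, if_neg h.ne, Finset.sum_attach (Icc (k + 1) n) (fun j => doc a n j * a j k)]

/-- The discrete (left-)complementary convolution (DCC) kernels:
`dcc a n k` is `p^{(n)}_{n-k} = ∑_{j=k}^n θ^{(j)}_{j-k}`. -/
def dcc (a : ℕ → ℕ → ℝ) (n k : ℕ) : ℝ := ∑ j ∈ Icc k n, doc a j k

/-- The right-complementary convolution (RCC) kernels: `rcc a n k` is the RCC kernel with
superscript `n` and subscript `n-k`, that is `∑_{j=k}^n θ^{(n)}_{n-j}`. -/
def rcc (a : ℕ → ℕ → ℝ) (n k : ℕ) : ℝ := ∑ j ∈ Icc k n, doc a n j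

/-- The discrete convolution `∑_{l=1}^j a^{(j)}_{j-l} w_l`; it is `0` at `j = 0`. -/
def conv (a : ℕ → ℕ → ℝ) (w : ℕ → ℝ) (j : ℕ) : ℝ := ∑ l ∈ Icc 1 j, a j l * w l

/-- The discrete gradient structure equality at level `n` for the kernels `a`: with `p`, `q` the DCC
and RCC kernels of the modified kernels and `v` the convolution of the modified kernels with `w`
(so that `v_0 = 0`). The RCC kernel with subscript `n-j-1` is `q n (j + 1)`. -/
def DGSEquality (a : ℕ → ℕ → ℝ) (w : ℕ → ℝ) (n : ℕ) : Prop :=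
  let p := dcc (modified a)
  let q := rcc (modified a)
  let v := conv (modified a) w
  2 * w n * ∑ j ∈ Icc 1 n, a n j * w j =
    ∑ j ∈ Icc 1 n, p n j * v j ^ 2 - ∑ j ∈ Icc 1 (n - 1), p (n - 1) j * v j ^ 2
      + ∑ j ∈ Icc 1 (n - 1), (1 / q n j - 1 / q n (j + 1)) *
          (∑ k ∈ Icc 1 j, q n k * (v k - v (k - 1))) ^ 2

end IAF

end

noncomputable section

open Finset

namespace IAF

/-! ### Complementary kernels of a triangular kernel -/

section Triangular

variable {A : ℕ → ℕ → ℝ}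

/-! Write `A` for the modified kernels. Everything follows from four properties of `A`, collected in
`IsGradientKernel`: positivity, strict decrease down columns, strict increase along rows, and a
cross inequality saying that the ratio of column `k` to column `k + 1` does not decrease with `j`.
The cross inequality makes the off-diagonal DOC kernels nonpositive; with column decrease this gives
`rcc > 0`, and row increase gives `dcc > 0`.

The gradient structure itself is algebra. DOC kernels invert convolution, so summation by parts
writes `w n` as the sum of `q n k * (v k - v (k - 1))`. As `q n n` is the reciprocal of the doubled
diagonal, the left side is `2 * w n * v n - w n ^ 2 / q n n`, which a telescoping identity expands.
Nonpositive DOC kernels make `q n j` nondecreasing in `j`, so the extra squares have nonnegative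
weights, and summing over levels gives positive definiteness.

For the four properties, `A j k` is a constant times the mean of `(x - s) ^ (β - 1)` over a
rectangle; doubling turns the diagonal entry into the mean of `|x - s| ^ (β - 1)` over the full
square. Monotonicity is concavity of powers. The cross inequality away from the diagonal is
inherited pointwise from the kernel. Only when it involves a diagonal entry is the step ratio
condition needed; after rescaling, this case is `rho_mul_rho_le`. -/

theorem sum_doc_mul_of_lt {n k : ℕ} (hk : A k k ≠ 0) (h : k < n) :
    ∑ j ∈ Icc k n, doc A n j * A j k = 0 := by
  rw [← Finset.add_sum_Ioc_eq_sum_Icc h.le, ← Finset.Icc_add_one_left_eq_Ioc, doc_of_lt A h]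
  field_simp
  ring

theorem sum_doc_mul_self {n : ℕ} (hn : A n n ≠ 0) :
    ∑ j ∈ Icc n n, doc A n j * A j n = 1 := by
  simp [doc_self, hn]

/-- The DCC kernels are a left inverse of the kernels up to summation. -/
theorem sum_dcc_mul {n k : ℕ} (hk : A k k ≠ 0) (h : k ≤ n) :
    ∑ j ∈ Icc k n, dcc A n j * A j k = 1 := by
  have h1 : ∑ j ∈ Icc k n, dcc A n j * A j k
      = ∑ i ∈ Icc k n, ∑ j ∈ Icc k i, doc A i j * A j k := by
    simp only [dcc, Finset.sum_mul]
    apply Finset.sum_comm'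
    intro x y
    simp only [Finset.mem_Icc]
    omega
  rw [h1, Finset.sum_eq_single k]
  · exact sum_doc_mul_self hk
  · intro i hi hik
    rw [Finset.mem_Icc] at hi
    exact sum_doc_mul_of_lt hk (by omega)
  · intro hk'
    exact absurd (Finset.mem_Icc.2 ⟨le_rfl, h⟩) hk'

/-- Convolution with the DOC kernels inverts convolution with the kernels. -/
theorem sum_doc_mul_conv {n : ℕ} (hA : ∀ k, 1 ≤ k → k ≤ n → A k k ≠ 0) (hn : 1 ≤ n)
    (w : ℕ → ℝ) : ∑ j ∈ Icc 1 n, doc A n j * conv A w j = w n := by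
  have h1 : ∑ j ∈ Icc 1 n, doc A n j * conv A w j
      = ∑ l ∈ Icc 1 n, (∑ j ∈ Icc l n, doc A n j * A j l) * w l := by
    simp only [conv, Finset.sum_mul, Finset.mul_sum, ← mul_assoc]
    apply Finset.sum_comm'
    intro x y
    simp only [Finset.mem_Icc]
    omega
  rw [h1, Finset.sum_eq_single n]
  · rw [sum_doc_mul_self (hA n hn le_rfl), one_mul]
  · intro i hi hin
    rw [Finset.mem_Icc] at hi
    rw [sum_doc_mul_of_lt (hA i hi.1 hi.2) (by omega), zero_mul]
  · intro hn'
    exact absurd (Finset.mem_Icc.2 ⟨hn, le_rfl⟩) hn'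

theorem rcc_self (n : ℕ) : rcc A n n = 1 / A n n := by
  simp [rcc, doc_self]

theorem rcc_eq_add {n k : ℕ} (h : k ≤ n) : rcc A n k = doc A n k + rcc A n (k + 1) := by
  rw [rcc, rcc, ← Finset.add_sum_Ioc_eq_sum_Icc h, ← Finset.Icc_add_one_left_eq_Ioc]

/-- Summation by parts, with the RCC kernels as the partial sums of the DOC kernels. -/
theorem sum_doc_mul_eq_sum_rcc (n : ℕ) (v : ℕ → ℝ) (h0 : v 0 = 0) :
    ∑ j ∈ Icc 1 n, doc A n j * v j = ∑ k ∈ Icc 1 n, rcc A n k * (v k - v (k - 1)) := by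
  -- The partial sums carry a boundary term `rcc A n (m + 1) * v m`; at `m = n` it is an empty sum
  -- times `v n`.
  have key : ∀ m ≤ n, ∑ j ∈ Icc 1 m, doc A n j * v j
      = ∑ k ∈ Icc 1 m, rcc A n k * (v k - v (k - 1)) - rcc A n (m + 1) * v m := by
    intro m
    induction m with
    | zero => intro _; simp [h0]
    | succ m ih =>
      intro hm
      rw [Finset.sum_Icc_succ_top (by omega), Finset.sum_Icc_succ_top (by omega),
        ih (by omega), Nat.add_sub_cancel, rcc_eq_add hm]
      ring
  rw [key n le_rfl]
  simp [rcc]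

/-- The DOC kernels off the diagonal are nonpositive. -/
theorem doc_nonpos {n : ℕ} (hpos : ∀ j k, 1 ≤ k → k ≤ j → j ≤ n → 0 < A j k)
    (hcross : ∀ j k, 1 ≤ k → k + 1 ≤ j → j + 1 ≤ n →
      A j k * A (j + 1) (k + 1) ≤ A (j + 1) k * A j (k + 1))
    {k : ℕ} (hk : 1 ≤ k) (hkn : k < n) : doc A n k ≤ 0 := by
  -- Chaining the cross inequality over consecutive rows compares row `j` directly with the last row
  -- `n`.
  have hmono : ∀ k, 1 ≤ k → ∀ j, k + 1 ≤ j → j ≤ n →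
      A j k * A n (k + 1) ≤ A n k * A j (k + 1) := by
    intro k hk j hj hjn
    have hm : ∀ m, j ≤ m → m ≤ n → A j k * A m (k + 1) ≤ A m k * A j (k + 1) := by
      intro m hjm
      induction m, hjm using Nat.le_induction with
      | base => intro _; exact le_rfl
      | succ m hjm ih =>
        intro hmn
        have h1 := ih (by omega)
        have h2 := hcross m k hk (by omega) hmn
        have p1 := hpos m (k + 1) (by omega) (by omega) (by omega)
        have p2 := hpos (m + 1) (k + 1) (by omega) (by omega) (by omega)
        have p3 := hpos j (k + 1) (by omega) (by omega) (by omega)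
        refine le_of_mul_le_mul_right ?_ p1
        calc A j k * A (m + 1) (k + 1) * A m (k + 1)
            = (A j k * A m (k + 1)) * A (m + 1) (k + 1) := by ring
          _ ≤ (A m k * A j (k + 1)) * A (m + 1) (k + 1) := by gcongr
          _ = (A m k * A (m + 1) (k + 1)) * A j (k + 1) := by ring
          _ ≤ (A (m + 1) k * A m (k + 1)) * A j (k + 1) := by gcongr
          _ = A (m + 1) k * A j (k + 1) * A m (k + 1) := by ring
    exact hm n hjn le_rfl
  have main : ∀ d k, k + d + 1 = n → 1 ≤ k → doc A n k ≤ 0 := by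
    intro d
    induction d using Nat.strong_induction_on with
    | _ d ih =>
      intro k hd hk
      have hkk := hpos k k hk le_rfl (by omega)
      have hsum : 0 ≤ ∑ j ∈ Icc (k + 1) n, doc A n j * A j k := by
        rcases Nat.eq_zero_or_pos d with rfl | hdpos
        · have : n = k + 1 := by omega
          subst this
          have := hpos (k + 1) (k + 1) (by omega) le_rfl le_rfl
          have := hpos (k + 1) k hk (by omega) le_rfl
          simp only [Icc_self, sum_singleton, doc_self]
          positivity
        · have pn := hpos n (k + 1) (by omega) (by omega) le_rfl
          have hz := sum_doc_mul_of_lt (A := A) (n := n) (k := k + 1)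
            (hpos _ _ (by omega) le_rfl (by omega)).ne' (by omega)
          -- Subtracting `A n k` times the orthogonality relation for column `k + 1` removes the
          -- positive diagonal kernel `doc A n n`: the term `j = n` vanishes, and every other term
          -- is a product of two nonpositive factors.
          have he : (∑ j ∈ Icc (k + 1) n, doc A n j * A j k) * A n (k + 1)
              = ∑ j ∈ Icc (k + 1) n,
                  doc A n j * (A j k * A n (k + 1) - A n k * A j (k + 1)) := by
            rw [← sub_zero ((∑ j ∈ Icc (k + 1) n, doc A n j * A j k) * A n (k + 1)),
              ← mul_zero (A n k), ← hz, Finset.sum_mul, Finset.mul_sum, ← Finset.sum_sub_distrib]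
            exact Finset.sum_congr rfl fun j _ => by ring
          refine nonneg_of_mul_nonneg_left (b := A n (k + 1)) ?_ pn
          rw [he]
          refine Finset.sum_nonneg fun j hj => ?_
          rw [Finset.mem_Icc] at hj
          rcases eq_or_lt_of_le hj.2 with rfl | hjn
          · simp
          · have h1 := ih (n - j - 1) (by omega) j (by omega) (by omega)
            have h2 := hmono k hk j hj.1 hj.2
            exact mul_nonneg_of_nonpos_of_nonpos h1 (by linarith)
      rw [doc_of_lt A (by omega), neg_mul]
      have : 0 ≤ 1 / A k k * ∑ j ∈ Icc (k + 1) n, doc A n j * A j k := by positivity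
      linarith
  exact main (n - k - 1) k (by omega) hk

/-- Positivity of the RCC kernels. -/
theorem rcc_pos {n : ℕ} (hpos : ∀ j k, 1 ≤ k → k ≤ j → j ≤ n → 0 < A j k)
    (hcol : ∀ j k, 1 ≤ k → k ≤ j → j + 1 ≤ n → A (j + 1) k < A j k)
    (hdoc : ∀ k, 1 ≤ k → k < n → doc A n k ≤ 0)
    {k : ℕ} (hk : 1 ≤ k) (hkn : k ≤ n) : 0 < rcc A n k := by
  have hnn : 0 < doc A n n := by
    rw [doc_self]; exact one_div_pos.2 (hpos n n (by omega) le_rfl le_rfl)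
  rcases eq_or_lt_of_le hkn with rfl | hlt
  · simpa [rcc] using hnn
  have hanti : ∀ j, k ≤ j → j < n → A n k < A j k := by
    intro j hkj hjn
    have hm : ∀ m, j + 1 ≤ m → m ≤ n → A m k < A j k := by
      intro m hjm
      induction m, hjm using Nat.le_induction with
      | base => intro h; exact hcol j k hk hkj h
      | succ m hjm ih => intro h; exact (hcol m k hk (by omega) h).trans (ih (by omega))
    exact hm n hjn le_rfl
  by_contra hq
  rw [not_lt] at hq
  have pn := hpos n k hk hkn le_rfl
  have hterm : ∀ j ∈ Icc k n, doc A n j * (A j k - A n k) ≤ 0 := by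
    intro j hj
    rw [Finset.mem_Icc] at hj
    rcases eq_or_lt_of_le hj.2 with rfl | hjn
    · simp
    · exact mul_nonpos_of_nonpos_of_nonneg (hdoc j (by omega) hjn)
        (sub_nonneg.2 (hanti j hj.1 hjn).le)
  -- By orthogonality only the constant `A n k` contributes. If `rcc A n k` were nonpositive, this
  -- sum of nonpositive terms would vanish termwise, leaving `rcc A n k = doc A n n > 0`.
  have hsum : ∑ j ∈ Icc k n, doc A n j * (A j k - A n k) = - (rcc A n k * A n k) := by
    simp only [mul_sub, Finset.sum_sub_distrib, rcc, Finset.sum_mul]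
    rw [sum_doc_mul_of_lt (hpos k k hk le_rfl hkn).ne' hlt, zero_sub]
  have hzero : ∑ j ∈ Icc k n, doc A n j * (A j k - A n k) = 0 := by
    refine le_antisymm (Finset.sum_nonpos hterm) ?_
    rw [hsum]
    nlinarith
  rw [Finset.sum_eq_zero_iff_of_nonpos hterm] at hzero
  have hr : rcc A n k = doc A n n := by
    rw [rcc]
    refine Finset.sum_eq_single n (fun j hj hjn => ?_) (fun h => ?_)
    · have h1 := hzero j hj
      rw [Finset.mem_Icc] at hj
      exact (mul_eq_zero.1 h1).resolve_right
        (sub_pos.2 (hanti j hj.1 (by omega))).ne'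
    · exact absurd (Finset.mem_Icc.2 ⟨hkn, le_rfl⟩) h
  linarith

/-- Positivity of the DCC kernels. -/
theorem dcc_pos {n : ℕ} (hpos : ∀ j k, 1 ≤ k → k ≤ j → j ≤ n → 0 < A j k)
    (hrow : ∀ j k, 1 ≤ k → k + 1 ≤ j → j ≤ n → A j k < A j (k + 1))
    {k : ℕ} (hk : 1 ≤ k) (hkn : k ≤ n) : 0 < dcc A n k := by
  have main : ∀ d k, k + d = n → 1 ≤ k → 0 < dcc A n k := by
    intro d
    induction d using Nat.strong_induction_on with
    | _ d ih =>
      intro k hd hk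
      have hkk := hpos k k hk le_rfl (by omega)
      rcases Nat.eq_zero_or_pos d with rfl | hdpos
      · obtain rfl : k = n := by omega
        simp only [dcc, Icc_self, sum_singleton, doc_self]
        positivity
      · have h1 := sum_dcc_mul (A := A) (n := n) (k := k) hkk.ne' (by omega)
        have h2 := sum_dcc_mul (A := A) (n := n) (k := k + 1)
          (hpos _ _ (by omega) le_rfl (by omega)).ne' (by omega)
        rw [← Finset.add_sum_Ioc_eq_sum_Icc (by omega), ← Finset.Icc_add_one_left_eq_Ioc] at h1
        -- The right side equals 1 by `h2`, so in `h1` the term `j = k` must be positive.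
        have h3 : ∑ j ∈ Icc (k + 1) n, dcc A n j * A j k
            < ∑ j ∈ Icc (k + 1) n, dcc A n j * A j (k + 1) := by
          refine Finset.sum_lt_sum_of_nonempty (Finset.nonempty_Icc.2 (by omega)) fun j hj => ?_
          rw [Finset.mem_Icc] at hj
          exact mul_lt_mul_of_pos_left (hrow j k hk hj.1 hj.2)
            (ih (n - j) (by omega) j (by omega) (by omega))
        exact pos_of_mul_pos_left (b := A k k) (by linarith) hkk.le
  exact main (n - k) k (by omega) hk

end Triangular

/-! ### The discrete gradient structure -/

section GradientStructure

variable {a : ℕ → ℕ → ℝ}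

theorem modified_self (n : ℕ) : modified a n n = 2 * a n n := if_pos rfl

theorem modified_of_lt {n k : ℕ} (h : k < n) : modified a n k = a n k := if_neg h.ne

theorem conv_zero (A : ℕ → ℕ → ℝ) (w : ℕ → ℝ) : conv A w 0 = 0 := by simp [conv]

theorem conv_modified {n : ℕ} (hn : 1 ≤ n) (w : ℕ → ℝ) :
    conv (modified a) w n = ∑ j ∈ Icc 1 n, a n j * w j + a n n * w n := by
  obtain ⟨m, rfl⟩ : ∃ m, n = m + 1 := ⟨n - 1, by omega⟩
  rw [conv, Finset.sum_Icc_succ_top (by omega), Finset.sum_Icc_succ_top (by omega), modified_self]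
  have : ∑ l ∈ Icc 1 m, modified a (m + 1) l * w l = ∑ l ∈ Icc 1 m, a (m + 1) l * w l := by
    refine Finset.sum_congr rfl fun l hl => ?_
    rw [Finset.mem_Icc] at hl
    rw [modified_of_lt (by omega)]
  rw [this]
  ring

theorem sum_dcc_sub_sum_dcc (A : ℕ → ℕ → ℝ) {n : ℕ} (hn : 1 ≤ n) (u : ℕ → ℝ) :
    ∑ j ∈ Icc 1 n, dcc A n j * u j - ∑ j ∈ Icc 1 (n - 1), dcc A (n - 1) j * u j
      = ∑ j ∈ Icc 1 n, doc A n j * u j := by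
  obtain ⟨m, rfl⟩ : ∃ m, n = m + 1 := ⟨n - 1, by omega⟩
  rw [Nat.add_sub_cancel, Finset.sum_Icc_succ_top (by omega), Finset.sum_Icc_succ_top (by omega)]
  have h1 : dcc A (m + 1) (m + 1) = doc A (m + 1) (m + 1) := by simp [dcc]
  have h2 : ∑ j ∈ Icc 1 m, dcc A (m + 1) j * u j
      = ∑ j ∈ Icc 1 m, dcc A m j * u j + ∑ j ∈ Icc 1 m, doc A (m + 1) j * u j := by
    rw [← Finset.sum_add_distrib]
    refine Finset.sum_congr rfl fun j hj => ?_
    rw [Finset.mem_Icc] at hj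
    rw [dcc, dcc, Finset.sum_Icc_succ_top (by omega)]
    ring
  rw [h1, h2]
  ring

/-- The telescoping identity behind the discrete gradient structure. -/
theorem two_mul_sum_mul_eq (q v : ℕ → ℝ) (h0 : v 0 = 0) (n : ℕ)
    (hq : ∀ k, 1 ≤ k → k ≤ n + 1 → q k ≠ 0) :
    2 * (∑ k ∈ Icc 1 (n + 1), q k * (v k - v (k - 1))) * v (n + 1)
        - 1 / q (n + 1) * (∑ k ∈ Icc 1 (n + 1), q k * (v k - v (k - 1))) ^ 2
      = ∑ k ∈ Icc 1 (n + 1), q k * (v k ^ 2 - v (k - 1) ^ 2)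
        + ∑ j ∈ Icc 1 n, (1 / q j - 1 / q (j + 1)) *
          (∑ k ∈ Icc 1 j, q k * (v k - v (k - 1))) ^ 2 := by
  induction n with
  | zero =>
    have := hq 1 le_rfl le_rfl
    simp [h0]
    field_simp
    ring
  | succ n ih =>
    have ih' := ih fun k hk hk' => hq k hk (by omega)
    have hq2 := hq (n + 2) (by omega) le_rfl
    have hq1 := hq (n + 1) (by omega) (by omega)
    rw [Finset.sum_Icc_succ_top (b := n + 1) (by omega),
      Finset.sum_Icc_succ_top (b := n + 1) (by omega),
      Finset.sum_Icc_succ_top (b := n) (f := fun j => (1 / q j - 1 / q (j + 1)) *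
          (∑ k ∈ Icc 1 j, q k * (v k - v (k - 1))) ^ 2) (by omega)]
    simp only [Nat.add_sub_cancel]
    set S := ∑ k ∈ Icc 1 (n + 1), q k * (v k - v (k - 1))
    set T := ∑ j ∈ Icc 1 n, (1 / q j - 1 / q (j + 1)) *
          (∑ k ∈ Icc 1 j, q k * (v k - v (k - 1))) ^ 2
    set Q := ∑ k ∈ Icc 1 (n + 1), q k * (v k ^ 2 - v (k - 1) ^ 2)
    have hT : T = 2 * S * v (n + 1) - 1 / q (n + 1) * S ^ 2 - Q := by linarith
    rw [hT]
    field_simp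
    ring

/-- Since `conv (modified a) w n` exceeds the plain convolution by `a n n * w n` and `1 / rcc n n =
2 * a n n`, the left side is `2 * w n * v n - w n ^ 2 / rcc n n`. The difference of the two DCC sums
is a DOC sum of `v j ^ 2`, hence by parts an RCC sum of its increments. -/
theorem dgsEquality_of_rcc_ne_zero {n : ℕ} (hn : 1 ≤ n)
    (hdiag : ∀ k, 1 ≤ k → k ≤ n → modified a k k ≠ 0)
    (hq : ∀ k, 1 ≤ k → k ≤ n → rcc (modified a) n k ≠ 0) (w : ℕ → ℝ) :
    DGSEquality a w n := by
  have h0 := conv_zero (modified a) w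
  unfold DGSEquality
  simp only
  rw [sum_dcc_sub_sum_dcc _ hn fun j => conv (modified a) w j ^ 2,
    sum_doc_mul_eq_sum_rcc n (fun j => conv (modified a) w j ^ 2) (by simp [h0])]
  obtain ⟨m, rfl⟩ : ∃ m, n = m + 1 := ⟨n - 1, by omega⟩
  rw [Nat.add_sub_cancel, ← two_mul_sum_mul_eq (rcc (modified a) (m + 1)) _ h0 m hq,
    ← sum_doc_mul_eq_sum_rcc (m + 1) _ h0, sum_doc_mul_conv hdiag hn, rcc_self, one_div_one_div,
    conv_modified hn, modified_self]
  ring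

/-- Monotonicity conditions on a kernel for positive complementary kernels. -/
structure IsGradientKernel (A : ℕ → ℕ → ℝ) (N : ℕ) : Prop where
  pos : ∀ j k, 1 ≤ k → k ≤ j → j ≤ N → 0 < A j k
  col : ∀ j k, 1 ≤ k → k ≤ j → j + 1 ≤ N → A (j + 1) k < A j k
  row : ∀ j k, 1 ≤ k → k + 1 ≤ j → j ≤ N → A j k < A j (k + 1)
  cross : ∀ j k, 1 ≤ k → k + 1 ≤ j → j + 1 ≤ N →
    A j k * A (j + 1) (k + 1) ≤ A (j + 1) k * A j (k + 1)

namespace IsGradientKernel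

variable {A : ℕ → ℕ → ℝ} {N : ℕ}

theorem doc_nonpos (h : IsGradientKernel A N) {n k : ℕ} (hk : 1 ≤ k) (hkn : k < n) (hn : n ≤ N) :
    doc A n k ≤ 0 :=
  IAF.doc_nonpos (fun j k h1 h2 h3 => h.pos j k h1 h2 (h3.trans hn))
    (fun j k h1 h2 h3 => h.cross j k h1 h2 (h3.trans hn)) hk hkn

theorem rcc_pos (h : IsGradientKernel A N) {n k : ℕ} (hk : 1 ≤ k) (hkn : k ≤ n) (hn : n ≤ N) :
    0 < rcc A n k :=
  IAF.rcc_pos (fun j k h1 h2 h3 => h.pos j k h1 h2 (h3.trans hn))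
    (fun j k h1 h2 h3 => h.col j k h1 h2 (h3.trans hn))
    (fun _ h1 h2 => h.doc_nonpos h1 h2 hn) hk hkn

theorem dcc_pos (h : IsGradientKernel A N) {n k : ℕ} (hk : 1 ≤ k) (hkn : k ≤ n) (hn : n ≤ N) :
    0 < dcc A n k :=
  IAF.dcc_pos (fun j k h1 h2 h3 => h.pos j k h1 h2 (h3.trans hn))
    (fun j k h1 h2 h3 => h.row j k h1 h2 (h3.trans hn)) hk hkn

theorem dgsEquality (h : IsGradientKernel (modified a) N) {n : ℕ} (hn : 1 ≤ n) (hnN : n ≤ N)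
    (w : ℕ → ℝ) : DGSEquality a w n :=
  dgsEquality_of_rcc_ne_zero hn (fun k h1 h2 => (h.pos k k h1 le_rfl (h2.trans hnN)).ne')
    (fun _ h1 h2 => (h.rcc_pos h1 h2 hnN).ne') w

/-- Adding the gradient equality over all levels telescopes the DCC sums. The discarded squares have
nonnegative weights because `rcc n j = doc n j + rcc n (j + 1)` with `doc n j ≤ 0`. -/
theorem sum_dcc_mul_sq_le (h : IsGradientKernel (modified a) N) {n : ℕ} (hnN : n ≤ N)
    (w : ℕ → ℝ) :
    ∑ k ∈ Icc 1 n, dcc (modified a) n k * conv (modified a) w k ^ 2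
      ≤ 2 * ∑ k ∈ Icc 1 n, w k * ∑ j ∈ Icc 1 k, a k j * w j := by
  induction n with
  | zero => simp
  | succ n ih =>
    have ih' := ih (by omega)
    have hE := h.dgsEquality (n := n + 1) (by omega) hnN w
    unfold DGSEquality at hE
    simp only [Nat.add_sub_cancel] at hE
    have hnn : 0 ≤ ∑ j ∈ Icc 1 n,
        (1 / rcc (modified a) (n + 1) j - 1 / rcc (modified a) (n + 1) (j + 1)) *
          (∑ k ∈ Icc 1 j, rcc (modified a) (n + 1) k *
            (conv (modified a) w k - conv (modified a) w (k - 1))) ^ 2 := by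
      refine Finset.sum_nonneg fun j hj => mul_nonneg (sub_nonneg.2 ?_) (sq_nonneg _)
      rw [Finset.mem_Icc] at hj
      refine one_div_le_one_div_of_le (h.rcc_pos hj.1 (by omega) hnN) ?_
      have := h.doc_nonpos (n := n + 1) hj.1 (by omega) hnN
      rw [rcc_eq_add (show j ≤ n + 1 by omega)]
      linarith
    rw [Finset.sum_Icc_succ_top (f := fun k => w k * _) (by omega)]
    linarith

/-- If the sum vanished, all convolutions up to level `n` would vanish, and the DOC kernels recover
`w` from them. -/
theorem sum_dcc_mul_sq_pos (h : IsGradientKernel A N) {n : ℕ} (hnN : n ≤ N) (w : ℕ → ℝ)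
    (hw : ∃ k, 1 ≤ k ∧ k ≤ n ∧ w k ≠ 0) :
    0 < ∑ k ∈ Icc 1 n, dcc A n k * conv A w k ^ 2 := by
  have hnn : ∀ k ∈ Icc 1 n, 0 ≤ dcc A n k * conv A w k ^ 2 := by
    intro k hk
    rw [Finset.mem_Icc] at hk
    exact mul_nonneg (h.dcc_pos hk.1 hk.2 hnN).le (sq_nonneg _)
  refine (Finset.sum_nonneg hnn).lt_of_ne fun h0 => ?_
  obtain ⟨m, hm1, hmn, hwm⟩ := hw
  rw [eq_comm, Finset.sum_eq_zero_iff_of_nonneg hnn] at h0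
  apply hwm
  rw [← sum_doc_mul_conv (A := A) (fun k h1 h2 => (h.pos k k h1 le_rfl (by omega)).ne') hm1 w]
  refine Finset.sum_eq_zero fun j hj => ?_
  rw [Finset.mem_Icc] at hj
  have h1 := h0 j (Finset.mem_Icc.2 ⟨hj.1, by omega⟩)
  have h2 := (mul_eq_zero.1 h1).resolve_left (h.dcc_pos hj.1 (by omega) hnN).ne'
  rw [pow_eq_zero_iff two_ne_zero] at h2
  rw [h2, mul_zero]

end IsGradientKernel

end GradientStructure

/-! ### Second differences of the power function -/

/-- If `F' / G'` is increasing, so are the quotients of the increments of `F` and `G`. -/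
theorem sub_mul_sub_le_of_deriv_cross {F G F' G' : ℝ → ℝ} {a b c : ℝ} (hab : a < b) (hbc : b < c)
    (hF : ContinuousOn F (Set.Icc a c)) (hG : ContinuousOn G (Set.Icc a c))
    (hF' : ∀ x ∈ Set.Ioo a c, HasDerivAt F (F' x) x)
    (hG' : ∀ x ∈ Set.Ioo a c, HasDerivAt G (G' x) x)
    (hpos : ∀ x ∈ Set.Ioo a c, 0 < G' x)
    (hcross : ∀ x ∈ Set.Ioo a c, ∀ y ∈ Set.Ioo a c, x < y → F' x * G' y ≤ F' y * G' x) :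
    (F b - F a) * (G c - G b) ≤ (F c - F b) * (G b - G a) := by
  have s1 : Set.Icc a b ⊆ Set.Icc a c := Set.Icc_subset_Icc le_rfl hbc.le
  have s2 : Set.Icc b c ⊆ Set.Icc a c := Set.Icc_subset_Icc hab.le le_rfl
  have o1 : Set.Ioo a b ⊆ Set.Ioo a c := Set.Ioo_subset_Ioo le_rfl hbc.le
  have o2 : Set.Ioo b c ⊆ Set.Ioo a c := Set.Ioo_subset_Ioo hab.le le_rfl
  -- Cauchy's mean value theorem on the two intervals gives `x < b < y`, where the derivative ratios
  -- can be compared; the ordinary mean value theorem below only supplies the sign of the increments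
  -- of `G`.
  obtain ⟨x, hx, ex⟩ := exists_ratio_hasDerivAt_eq_ratio_slope F F' hab (hF.mono s1)
    (fun x hx => hF' x (o1 hx)) G G' (hG.mono s1) (fun x hx => hG' x (o1 hx))
  obtain ⟨y, hy, ey⟩ := exists_ratio_hasDerivAt_eq_ratio_slope F F' hbc (hF.mono s2)
    (fun x hx => hF' x (o2 hx)) G G' (hG.mono s2) (fun x hx => hG' x (o2 hx))
  obtain ⟨u, hu, eu⟩ := exists_hasDerivAt_eq_slope G G' hab (hG.mono s1)
    (fun x hx => hG' x (o1 hx))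
  obtain ⟨v, hv, ev⟩ := exists_hasDerivAt_eq_slope G G' hbc (hG.mono s2)
    (fun x hx => hG' x (o2 hx))
  have g1 : 0 < G b - G a := by
    have := hpos u (o1 hu)
    rw [eu] at this
    exact (div_pos_iff_of_pos_right (sub_pos.2 hab)).1 this
  have g2 : 0 < G c - G b := by
    have := hpos v (o2 hv)
    rw [ev] at this
    exact (div_pos_iff_of_pos_right (sub_pos.2 hbc)).1 this
  have px := hpos x (o1 hx)
  have py := hpos y (o2 hy)
  have hxy := hcross x (o1 hx) y (o2 hy) (hx.2.trans hy.1)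
  refine le_of_mul_le_mul_right ?_ (mul_pos px py)
  calc (F b - F a) * (G c - G b) * (G' x * G' y)
      = ((F b - F a) * G' x) * ((G c - G b) * G' y) := by ring
    _ = (G b - G a) * (G c - G b) * (F' x * G' y) := by rw [← ex]; ring
    _ ≤ (G b - G a) * (G c - G b) * (F' y * G' x) := by gcongr
    _ = ((G c - G b) * F' y) * ((G b - G a) * G' x) := by ring
    _ = (F c - F b) * (G b - G a) * (G' x * G' y) := by rw [ey]; ring

/-- For `s < u` and `x < y`, `(x - s) * (y - u) - (x - u) * (y - s) = (y - x) * (u - s) > 0`, and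
the power `β - 1 < 0` reverses the comparison. This is the cross inequality integrated in `s` only.
-/
theorem rpow_increment_cross {β : ℝ} (hβ0 : 0 < β) (hβ1 : β < 1) {c₀ c₁ c₂ x y : ℝ}
    (h01 : c₀ < c₁) (h12 : c₁ < c₂) (h2x : c₂ < x) (hxy : x < y) :
    ((x - c₀) ^ β - (x - c₁) ^ β) * ((y - c₁) ^ β - (y - c₂) ^ β)
      ≤ ((y - c₀) ^ β - (y - c₁) ^ β) * ((x - c₁) ^ β - (x - c₂) ^ β) := by
  have hc : ∀ z, ContinuousOn (fun s : ℝ => -(z - s) ^ β) (Set.Icc c₀ c₂) := fun z =>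
    ((continuous_const.sub continuous_id).rpow_const fun _ => Or.inr hβ0.le).neg.continuousOn
  have hd : ∀ z, c₂ < z → ∀ s ∈ Set.Ioo c₀ c₂,
      HasDerivAt (fun s : ℝ => -(z - s) ^ β) (β * (z - s) ^ (β - 1)) s := by
    intro z hz s hs
    have h1 : z - s ≠ 0 := by have := hs.2; linarith
    exact (((hasDerivAt_id' s).const_sub z).rpow_const (p := β) (Or.inl h1)).neg.congr_deriv
      (by ring)
  have key := sub_mul_sub_le_of_deriv_cross (F := fun s : ℝ => -(x - s) ^ β)
    (G := fun s : ℝ => -(y - s) ^ β) h01 h12 (hc x) (hc y) (hd x h2x) (hd y (h2x.trans hxy))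
    (fun s hs => mul_pos hβ0 (Real.rpow_pos_of_pos (by linarith [hs.2]) _)) ?_
  · linarith
  · intro s hs u hu hsu
    have e1 : 0 < x - s := by linarith [hs.2]
    have e2 : 0 < y - u := by linarith [hu.2]
    have e3 : 0 < x - u := by linarith [hu.2]
    have e4 : 0 < y - s := by linarith [hs.2]
    have h1 : (x - s) ^ (β - 1) * (y - u) ^ (β - 1) ≤ (x - u) ^ (β - 1) * (y - s) ^ (β - 1) := by
      rw [← Real.mul_rpow e1.le e2.le, ← Real.mul_rpow e3.le e4.le]
      refine Real.rpow_le_rpow_of_nonpos (mul_pos e3 e4) ?_ (by linarith)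
      nlinarith [mul_pos (sub_pos.2 hxy) (sub_pos.2 hsu)]
    have hb : 0 ≤ β * β := by positivity
    nlinarith [mul_le_mul_of_nonneg_left h1 hb]

/-- The mixed second difference of `x ↦ x ^ (1 + β)`: up to a constant, the integral of
`(x - s) ^ (β - 1)` over `a ≤ x ≤ b`, `c ≤ s ≤ d`. -/
def mixedDiff (β a b c d : ℝ) : ℝ :=
  (b - c) ^ (1 + β) - (a - c) ^ (1 + β) - (b - d) ^ (1 + β) + (a - d) ^ (1 + β)

/-- Reflection exchanges the roles of the two intervals, so monotonicity in one gives monotonicity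
in the other. -/
theorem mixedDiff_neg (β a b c d : ℝ) :
    mixedDiff β (-d) (-c) (-b) (-a) = mixedDiff β a b c d := by
  simp only [mixedDiff, neg_sub_neg]
  ring

theorem mixedDiff_add (β a b e c d : ℝ) :
    mixedDiff β a b c d + mixedDiff β b e c d = mixedDiff β a e c d := by
  simp only [mixedDiff]
  ring

section

variable {β : ℝ}

theorem continuous_sub_rpow_sub (hβ0 : 0 < β) (c d : ℝ) :
    Continuous fun x : ℝ => (x - c) ^ (1 + β) - (x - d) ^ (1 + β) :=
  ((continuous_id.sub continuous_const).rpow_const fun _ => Or.inr (by linarith)).sub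
    ((continuous_id.sub continuous_const).rpow_const fun _ => Or.inr (by linarith))

theorem hasDerivAt_sub_rpow_sub (hβ0 : 0 < β) (c d x : ℝ) :
    HasDerivAt (fun x : ℝ => (x - c) ^ (1 + β) - (x - d) ^ (1 + β))
      ((1 + β) * ((x - c) ^ β - (x - d) ^ β)) x := by
  have h : ∀ e : ℝ, HasDerivAt (fun x : ℝ => (x - e) ^ (1 + β)) ((1 + β) * (x - e) ^ β) x := by
    intro e
    exact (((hasDerivAt_id' x).sub_const e).rpow_const (p := 1 + β)
      (Or.inr (by linarith))).congr_deriv (by rw [one_mul, add_sub_cancel_left])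
  exact ((h c).fun_sub (h d)).congr_deriv (by ring)

theorem mixedDiff_pos (hβ0 : 0 < β) {a b c d : ℝ} (hcd : c < d) (hda : d ≤ a) (hab : a < b) :
    0 < mixedDiff β a b c d := by
  obtain ⟨x, hx, ex⟩ := exists_hasDerivAt_eq_slope
    (fun x : ℝ => (x - c) ^ (1 + β) - (x - d) ^ (1 + β)) _ hab
    (continuous_sub_rpow_sub hβ0 c d).continuousOn (fun x _ => hasDerivAt_sub_rpow_sub hβ0 c d x)
  have h1 : (x - d) ^ β < (x - c) ^ β :=
    Real.rpow_lt_rpow (by linarith [hx.1]) (by linarith) hβ0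
  have h2 : 0 < (1 + β) * ((x - c) ^ β - (x - d) ^ β) := mul_pos (by linarith) (by linarith)
  rw [ex] at h2
  have h3 := (div_pos_iff_of_pos_right (sub_pos.2 hab)).1 h2
  unfold mixedDiff
  linarith

/-- The integration in `x`, applied to `rpow_increment_cross`. The intervals may touch but not
overlap, so no diagonal entry is covered. -/
theorem mixedDiff_cross (hβ0 : 0 < β) (hβ1 : β < 1)
    {a₀ a₁ a₂ c₀ c₁ c₂ : ℝ} (hc01 : c₀ < c₁) (hc12 : c₁ < c₂) (hca : c₂ ≤ a₀)
    (ha01 : a₀ < a₁) (ha12 : a₁ < a₂) :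
    mixedDiff β a₀ a₁ c₀ c₁ * mixedDiff β a₁ a₂ c₁ c₂
      ≤ mixedDiff β a₁ a₂ c₀ c₁ * mixedDiff β a₀ a₁ c₁ c₂ := by
  have key := sub_mul_sub_le_of_deriv_cross ha01 ha12
    (continuous_sub_rpow_sub hβ0 c₀ c₁).continuousOn (continuous_sub_rpow_sub hβ0 c₁ c₂).continuousOn
    (fun x _ => hasDerivAt_sub_rpow_sub hβ0 c₀ c₁ x)
    (fun x _ => hasDerivAt_sub_rpow_sub hβ0 c₁ c₂ x) ?_ ?_
  · convert key using 1 <;> simp only [mixedDiff] <;> ring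
  · intro x hx
    have h1 : (x - c₂) ^ β < (x - c₁) ^ β :=
      Real.rpow_lt_rpow (by linarith [hx.1]) (by linarith) hβ0
    exact mul_pos (by linarith) (by linarith)
  · intro x hx y hy hxy
    have h1 := rpow_increment_cross hβ0 hβ1 hc01 hc12 (lt_of_le_of_lt hca hx.1) hxy
    have hb : 0 ≤ (1 + β) * (1 + β) := by positivity
    nlinarith [mul_le_mul_of_nonneg_left h1 hb]

/-- The derivative in `x`, a multiple of `(x - c) ^ β - (x - d) ^ β`, is strictly decreasing beyond
`d` because `β < 1`; so averages decrease as the interval moves away. -/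
theorem mixedDiff_slope (hβ0 : 0 < β) (hβ1 : β < 1)
    {a b e c d : ℝ} (hcd : c < d) (hda : d ≤ a) (hab : a < b) (hbe : b < e) :
    mixedDiff β b e c d * (b - a) < mixedDiff β a b c d * (e - b) := by
  obtain ⟨x, hx, ex⟩ := exists_hasDerivAt_eq_slope
    (fun x : ℝ => (x - c) ^ (1 + β) - (x - d) ^ (1 + β)) _ hab
    (continuous_sub_rpow_sub hβ0 c d).continuousOn (fun x _ => hasDerivAt_sub_rpow_sub hβ0 c d x)
  obtain ⟨y, hy, ey⟩ := exists_hasDerivAt_eq_slope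
    (fun x : ℝ => (x - c) ^ (1 + β) - (x - d) ^ (1 + β)) _ hbe
    (continuous_sub_rpow_sub hβ0 c d).continuousOn (fun x _ => hasDerivAt_sub_rpow_sub hβ0 c d x)
  have hxy : x < y := hx.2.trans hy.1
  have hanti : StrictAntiOn (fun x : ℝ => (x - c) ^ β - (x - d) ^ β) (Set.Ici d) := by
    refine strictAntiOn_of_deriv_neg (convex_Ici d) ?_ ?_
    · exact (((continuous_id.sub continuous_const).rpow_const fun _ => Or.inr hβ0.le).sub
        ((continuous_id.sub continuous_const).rpow_const fun _ => Or.inr hβ0.le)).continuousOn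
    · intro z hz
      rw [interior_Ici] at hz
      have hz' : d < z := hz
      have h : ∀ e < z, HasDerivAt (fun x : ℝ => (x - e) ^ β) (β * (z - e) ^ (β - 1)) z := by
        intro e he
        exact (((hasDerivAt_id' z).sub_const e).rpow_const (p := β)
          (Or.inl (by linarith))).congr_deriv (by rw [one_mul])
      rw [((h c (by linarith)).fun_sub (h d hz')).deriv]
      have h1 : (z - c) ^ (β - 1) < (z - d) ^ (β - 1) :=
        Real.rpow_lt_rpow_of_neg (by linarith) (by linarith) (by linarith)
      nlinarith
  have h1 := hanti (show x ∈ Set.Ici d from by have := hx.1; simp only [Set.mem_Ici]; linarith)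
    (show y ∈ Set.Ici d from by have := hy.1; simp only [Set.mem_Ici]; linarith) hxy
  simp only at h1
  have h2 := mul_lt_mul_of_pos_left h1 (show 0 < 1 + β by linarith)
  rw [ex, ey, div_lt_div_iff₀ (by linarith) (by linarith)] at h2
  unfold mixedDiff
  nlinarith

theorem mixedDiff_chord (hβ0 : 0 < β) (hβ1 : β < 1)
    {a b e c d : ℝ} (hcd : c < d) (hda : d ≤ a) (hab : a < b) (hbe : b < e) :
    mixedDiff β a e c d * (b - a) < mixedDiff β a b c d * (e - a) := by
  have h1 := mixedDiff_slope hβ0 hβ1 hcd hda hab hbe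
  rw [← mixedDiff_add β a b e c d]
  nlinarith

theorem mixedDiff_slope_left (hβ0 : 0 < β) (hβ1 : β < 1)
    {a b c d e : ℝ} (hcd : c < d) (hde : d < e) (hea : e ≤ a)
    (hab : a < b) :
    mixedDiff β a b c d * (e - d) < mixedDiff β a b d e * (d - c) := by
  have h := mixedDiff_slope hβ0 hβ1 (neg_lt_neg hab) (neg_le_neg hea) (neg_lt_neg hde)
    (neg_lt_neg hcd)
  rw [mixedDiff_neg, mixedDiff_neg] at h
  linarith

/-- The second difference over two adjacent intervals is below the one over a square. -/
theorem add_rpow_sub_lt (hβ0 : 0 < β) (hβ1 : β < 1) {x y : ℝ} (hx : 0 < x) (hy : 0 < y) :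
    (x + y) ^ (1 + β) - x ^ (1 + β) - y ^ (1 + β) < 2 * x * y ^ β := by
  obtain ⟨u, hu, eu⟩ := exists_hasDerivAt_eq_slope
    (fun x : ℝ => (x - (-y)) ^ (1 + β) - (x - 0) ^ (1 + β)) _ hx
    (continuous_sub_rpow_sub hβ0 (-y) 0).continuousOn
    (fun x _ => hasDerivAt_sub_rpow_sub hβ0 (-y) 0 x)
  have h1 : (u + y) ^ β ≤ u ^ β + y ^ β :=
    Real.rpow_add_le_add_rpow hu.1.le hy.le hβ0.le hβ1.le
  have hz : (0 : ℝ) ^ (1 + β) = 0 := Real.zero_rpow (by linarith)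
  have hyp := Real.rpow_pos_of_pos hy β
  simp only [sub_neg_eq_add, sub_zero, zero_add, hz] at eu
  rw [eq_div_iff hx.ne'] at eu
  -- Subadditivity of the power `β` bounds the increment by `y ^ β`, and `1 + β < 2` gives
  -- strictness; the 2 is that of the doubled diagonal.
  have h2 : (1 + β) * ((u + y) ^ β - u ^ β) < 2 * y ^ β := by nlinarith
  have h3 := mul_lt_mul_of_pos_right h2 hx
  rw [eu] at h3
  linarith

end

/-! ### The step ratio condition -/

section

variable {β : ℝ}

theorem rho_eq_mixedDiff (hβ0 : 0 < β) (z : ℝ) : rho β z = mixedDiff β 0 z (-1) 0 := by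
  have hz : (0 : ℝ) ^ (1 + β) = 0 := Real.zero_rpow (by linarith)
  simp only [rho, mixedDiff, sub_neg_eq_add, zero_add, sub_zero, hz, Real.one_rpow]
  ring

theorem rho_inv {z : ℝ} (hz : 0 < z) : rho β z = z ^ (1 + β) * rho β (1 / z) := by
  have h1 : 0 < z ^ (1 + β) := Real.rpow_pos_of_pos hz _
  have h2 : (1 / z + 1) ^ (1 + β) = (z + 1) ^ (1 + β) / z ^ (1 + β) := by
    rw [← Real.div_rpow (by linarith) hz.le]
    congr 1
    field_simp
    ring
  have h3 : (1 / z) ^ (1 + β) = 1 / z ^ (1 + β) := by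
    rw [Real.div_rpow zero_le_one hz.le, Real.one_rpow]
  rw [rho, rho, h2, h3]
  field_simp
  ring

theorem rho_pos (hβ0 : 0 < β) {z : ℝ} (hz : 0 < z) : 0 < rho β z := by
  rw [rho_eq_mixedDiff hβ0]
  exact mixedDiff_pos hβ0 (by norm_num) le_rfl hz

theorem rho_one : rho β 1 = 2 * (2 ^ β - 1) := by
  rw [rho, one_add_one_eq_two, Real.rpow_add two_pos, Real.one_rpow, Real.rpow_one]
  ring

/-- Concavity bounds `(2 - y) ^ β` below by the chord `(1 - y) * 2 ^ β + y`, and `y ^ β ≥ y`; the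
two bounds add up to exactly `2 ^ β`. -/
theorem two_rpow_le_of_mem_Icc (hβ0 : 0 < β) (hβ1 : β < 1) {y : ℝ} (hy0 : 0 ≤ y) (hy1 : y ≤ 1) :
    (2 : ℝ) ^ β ≤ (2 - y) ^ β + (2 ^ β - 1) * y ^ β := by
  have hc := Real.concaveOn_rpow hβ0.le hβ1.le
  have h1 := hc.2 (show (2 : ℝ) ∈ Set.Ici 0 by simp) (show (1 : ℝ) ∈ Set.Ici 0 by simp)
    (sub_nonneg.2 hy1) hy0 (by ring)
  simp only [smul_eq_mul, Real.one_rpow] at h1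
  rw [show (1 - y) * 2 + y * 1 = 2 - y by ring] at h1
  have h2 : y ≤ y ^ β := by
    rcases hy0.eq_or_lt with rfl | hy
    · rw [Real.zero_rpow hβ0.ne']
    · simpa using Real.rpow_le_rpow_of_exponent_ge hy hy1 hβ1.le
  have h3 : (1 : ℝ) ≤ 2 ^ β := Real.one_le_rpow (by norm_num) hβ0.le
  nlinarith [mul_le_mul_of_nonneg_left h2 (sub_nonneg.2 h3)]

theorem two_rpow_mul_le (hβ0 : 0 < β) (hβ1 : β < 1) {x : ℝ} (hx : 0 ≤ x) :
    (2 : ℝ) ^ β * (x + 1) ^ β ≤ (x + 2) ^ β + (2 ^ β - 1) * x ^ β := by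
  have hx1 : 0 < x + 1 := by linarith
  have h := two_rpow_le_of_mem_Icc hβ0 hβ1 (y := x / (x + 1)) (by positivity)
    ((div_le_one hx1).2 (by linarith))
  have e1 : 2 - x / (x + 1) = (x + 2) / (x + 1) := by field_simp; ring
  have hp := Real.rpow_pos_of_pos hx1 β
  rw [e1, Real.div_rpow (by linarith) hx1.le, Real.div_rpow hx hx1.le] at h
  calc (2 : ℝ) ^ β * (x + 1) ^ β
      ≤ ((x + 2) ^ β / (x + 1) ^ β + (2 ^ β - 1) * (x ^ β / (x + 1) ^ β)) * (x + 1) ^ β := by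
        gcongr
    _ = (x + 2) ^ β + (2 ^ β - 1) * x ^ β := by field_simp

/-- The step ratio condition at ratio `1`. -/
theorem rho_mul_le_mixedDiff_one (hβ0 : 0 < β) (hβ1 : β < 1) {x : ℝ} (hx : 0 < x) :
    (2 ^ β - 1) * rho β x ≤ mixedDiff β 0 1 (-(1 + x)) (-1) := by
  have hpow : ∀ e y : ℝ, HasDerivAt (fun y : ℝ => (y + e) ^ (1 + β)) ((1 + β) * (y + e) ^ β) y :=
    fun e y => (((hasDerivAt_id' y).add_const e).rpow_const (p := 1 + β)
      (Or.inr (by linarith))).congr_deriv (by rw [one_mul, add_sub_cancel_left])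
  -- The increment of this function over `[0, x]` is the right side minus the left side of the
  -- claim; its derivative is nonnegative by `two_rpow_mul_le`.
  have hd : ∀ y : ℝ, HasDerivAt
      (fun y : ℝ => (y + 2) ^ (1 + β) - 2 ^ β * (y + 1) ^ (1 + β) + (2 ^ β - 1) * (y + 0) ^ (1 + β))
      ((1 + β) * (y + 2) ^ β - 2 ^ β * ((1 + β) * (y + 1) ^ β)
        + (2 ^ β - 1) * ((1 + β) * (y + 0) ^ β)) y := fun y =>
    ((hpow 2 y).fun_sub ((hpow 1 y).const_mul _)).fun_add ((hpow 0 y).const_mul _)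
  obtain ⟨u, hu, eu⟩ := exists_hasDerivAt_eq_slope _ _ hx
    (fun y _ => (hd y).continuousAt.continuousWithinAt) (fun y _ => hd y)
  have h1 := two_rpow_mul_le hβ0 hβ1 hu.1.le
  have hz : (0 : ℝ) ^ (1 + β) = 0 := Real.zero_rpow (by linarith)
  have h2 : (2 : ℝ) ^ (1 + β) = 2 * 2 ^ β := by rw [Real.rpow_add two_pos, Real.rpow_one]
  simp only [sub_zero, zero_add, add_zero, hz, Real.one_rpow, h2] at eu
  rw [eq_div_iff hx.ne'] at eu
  have h3 : 0 ≤ (1 + β) * ((u + 2) ^ β + (2 ^ β - 1) * u ^ β - 2 ^ β * (u + 1) ^ β) * x :=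
    mul_nonneg (mul_nonneg (by linarith) (by linarith)) hx.le
  have e1 : mixedDiff β 0 1 (-(1 + x)) (-1)
      = (x + 2) ^ (1 + β) - (x + 1) ^ (1 + β) - 2 * 2 ^ β + 1 := by
    rw [mixedDiff, ← h2, show (1 : ℝ) - -(1 + x) = x + 2 by ring,
      show (0 : ℝ) - -(1 + x) = x + 1 by ring, show (1 : ℝ) - -1 = 2 by norm_num,
      show (0 : ℝ) - -1 = 1 by norm_num, Real.one_rpow]
  rw [e1, rho]
  linarith

/-- The step ratio condition controls the second difference over three adjacent intervals. -/
theorem rho_mul_rho_le (hβ0 : 0 < β) (hβ1 : β < 1)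
    {x z : ℝ} (hx : 0 < x) (hz : 0 < z) (h : rStar β (1 / x) ≤ z) :
    rho β x * rho β z ≤ 2 * mixedDiff β 0 z (-(1 + x)) (-1) := by
  have h2β : 0 < (2 : ℝ) ^ β - 1 := sub_pos.2 (Real.one_lt_rpow (by norm_num) hβ0)
  have hD : 0 < mixedDiff β 0 1 (-(1 + x)) (-1) :=
    mixedDiff_pos hβ0 (by linarith) (by norm_num) one_pos
  have hD1 := rho_mul_le_mixedDiff_one hβ0 hβ1 hx
  have hρx := rho_pos hβ0 hx
  have hρz := rho_pos hβ0 hz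
  have hρ1 := rho_one (β := β)
  set D := mixedDiff β 0 1 (-(1 + x)) (-1) with hDdef
  rcases le_or_gt 1 z with hz1 | hz1
  -- For `z ≥ 1` the quotient of the mixed difference by `rho β z` is at least its value at 1, so
  -- ratio 1 suffices and the hypothesis on `rStar` is not needed.
  · have hmono : D * rho β z ≤ mixedDiff β 0 z (-(1 + x)) (-1) * rho β 1 := by
      rcases hz1.eq_or_lt with rfl | hz1
      · exact le_rfl
      · have hc := mixedDiff_cross hβ0 hβ1 (show -(1 + x) < -1 by linarith)
          (show (-1 : ℝ) < 0 by norm_num) le_rfl one_pos hz1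
        rw [rho_eq_mixedDiff hβ0, rho_eq_mixedDiff hβ0, ← mixedDiff_add β 0 1 z,
          ← mixedDiff_add β 0 1 z]
        linarith
    rw [hρ1] at hmono
    refine le_of_mul_le_mul_left ?_ h2β
    nlinarith [mul_le_mul_of_nonneg_right hD1 hρz.le]
  -- For `z < 1`, concavity bounds the mixed difference below by `z * D` and `rho β z` above by `z ^
  -- β * rho β 1`. What remains is `hK`, which is `h` raised to the power `1 - β`.
  · have hE : D * (z - 0) < mixedDiff β 0 z (-(1 + x)) (-1) * (1 - 0) :=
      mixedDiff_chord hβ0 hβ1 (by linarith) (by norm_num) hz hz1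
    have hzz : 1 < 1 / z := (one_lt_div hz).2 hz1
    have hρ : rho β (1 / z) * (1 - 0) < rho β 1 * (1 / z - 0) := by
      rw [rho_eq_mixedDiff hβ0, rho_eq_mixedDiff hβ0]
      exact mixedDiff_chord hβ0 hβ1 (by norm_num) le_rfl one_pos hzz
    have hzβ := Real.rpow_pos_of_pos hz β
    have hρz' : rho β z ≤ z ^ β * rho β 1 := by
      rw [rho_inv hz, Real.rpow_add hz, Real.rpow_one]
      have : z * z ^ β * rho β (1 / z) ≤ z * z ^ β * (rho β 1 * (1 / z)) := by
        gcongr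
        linarith
      refine this.trans_eq ?_
      field_simp
    have hK : (2 ^ β - 1) * rho β x ≤ z ^ (1 - β) * D := by
      have hxp := Real.rpow_pos_of_pos hx (1 + β)
      have e1 : rho β (1 / x) = rho β x / x ^ (1 + β) := by
        rw [rho_inv hx]; field_simp
      have e2 : rho β (2 * (1 / x)) - rho β (1 / x) = D / x ^ (1 + β) := by
        rw [e1, rho, rho, hDdef, mixedDiff, show 2 * (1 / x) + 1 = (x + 2) / x by field_simp; ring,
          show 2 * (1 / x) = 2 / x by ring, Real.div_rpow (by linarith) hx.le,
          Real.div_rpow (by norm_num) hx.le, show (1 : ℝ) - -(1 + x) = x + 2 by ring,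
          show (0 : ℝ) - -(1 + x) = x + 1 by ring, show (1 : ℝ) - -1 = 2 by norm_num,
          show (0 : ℝ) - -1 = 1 by norm_num, Real.one_rpow]
        field_simp
        ring
      have e3 : rStar β (1 / x) = ((2 ^ β - 1) * rho β x / D) ^ (1 / (1 - β)) := by
        rw [rStar, e2, e1]
        congr 1
        field_simp
      have hK0 : 0 ≤ (2 ^ β - 1) * rho β x / D := by positivity
      have h4 := Real.rpow_le_rpow (Real.rpow_nonneg hK0 _) (e3 ▸ h) (sub_nonneg.2 hβ1.le)
      rw [← Real.rpow_mul hK0, one_div_mul_cancel (by linarith), Real.rpow_one] at h4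
      exact (div_le_iff₀ hD).1 h4
    have hzz' : z ^ β * z ^ (1 - β) = z := by
      rw [← Real.rpow_add hz, add_sub_cancel, Real.rpow_one]
    calc rho β x * rho β z ≤ rho β x * (z ^ β * rho β 1) := by gcongr
      _ = 2 * z ^ β * ((2 ^ β - 1) * rho β x) := by rw [hρ1]; ring
      _ ≤ 2 * z ^ β * (z ^ (1 - β) * D) := by gcongr
      _ = 2 * (D * (z ^ β * z ^ (1 - β))) := by ring
      _ = 2 * (D * z) := by rw [hzz']
      _ ≤ 2 * mixedDiff β 0 z (-(1 + x)) (-1) := by linarith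

theorem mixedDiff_affine {m y a b c d : ℝ} (hy : 0 ≤ y) (hcd : c ≤ d) (hda : d ≤ a) (hab : a ≤ b) :
    mixedDiff β (m + y * a) (m + y * b) (m + y * c) (m + y * d)
      = y ^ (1 + β) * mixedDiff β a b c d := by
  simp only [mixedDiff, add_sub_add_left_eq_sub, ← mul_sub]
  rw [Real.mul_rpow hy (by linarith), Real.mul_rpow hy (by linarith),
    Real.mul_rpow hy (by linarith), Real.mul_rpow hy (by linarith)]
  ring

/-- The cross inequality for three adjacent intervals. -/
theorem mixedDiff_cross_adjacent (hβ0 : 0 < β) (hβ1 : β < 1)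
    {c₀ c₁ c₂ c₃ : ℝ} (h01 : c₀ < c₁) (h12 : c₁ < c₂) (h23 : c₂ < c₃)
    (h : rStar β ((c₂ - c₁) / (c₁ - c₀)) ≤ (c₃ - c₂) / (c₂ - c₁)) :
    mixedDiff β c₁ c₂ c₀ c₁ * mixedDiff β c₂ c₃ c₁ c₂
      ≤ mixedDiff β c₂ c₃ c₀ c₁ * (2 * (c₂ - c₁) ^ (1 + β)) := by
  have hy : 0 < c₂ - c₁ := sub_pos.2 h12
  have hx : 0 < (c₁ - c₀) / (c₂ - c₁) := div_pos (sub_pos.2 h01) hy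
  have hz : 0 < (c₃ - c₂) / (c₂ - c₁) := div_pos (sub_pos.2 h23) hy
  -- The middle interval is scaled to `[-1, 0]`; `x` and `z` are the scaled outer lengths, so `1 /
  -- x` and `z` are the two step ratios.
  have key := rho_mul_rho_le hβ0 hβ1 hx hz (by rwa [one_div_div])
  set x := (c₁ - c₀) / (c₂ - c₁) with hxd
  set z := (c₃ - c₂) / (c₂ - c₁) with hzd
  have e0 : c₀ = c₂ + (c₂ - c₁) * (-(1 + x)) := by rw [hxd]; field_simp; ring
  have e1 : c₁ = c₂ + (c₂ - c₁) * (-1) := by ring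
  have e2 : c₂ = c₂ + (c₂ - c₁) * 0 := by ring
  have e3 : c₃ = c₂ + (c₂ - c₁) * z := by rw [hzd]; field_simp; ring
  have hyp := Real.rpow_pos_of_pos hy (1 + β)
  have w1 : mixedDiff β c₁ c₂ c₀ c₁ = (c₂ - c₁) ^ (1 + β) * rho β x := by
    have hρ : rho β x = mixedDiff β (-1) 0 (-(1 + x)) (-1) := by
      rw [rho_eq_mixedDiff hβ0, mixedDiff, mixedDiff]
      ring_nf
    rw [hρ, ← mixedDiff_affine (m := c₂) hy.le (by linarith) le_rfl (by norm_num),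
      ← e0, ← e1, ← e2]
  have w2 : mixedDiff β c₂ c₃ c₁ c₂ = (c₂ - c₁) ^ (1 + β) * rho β z := by
    rw [rho_eq_mixedDiff hβ0,
      ← mixedDiff_affine (m := c₂) hy.le (by norm_num) le_rfl hz.le, ← e1, ← e2, ← e3]
  have w3 : mixedDiff β c₂ c₃ c₀ c₁
      = (c₂ - c₁) ^ (1 + β) * mixedDiff β 0 z (-(1 + x)) (-1) := by
    rw [← mixedDiff_affine (m := c₂) hy.le (by linarith) (by norm_num) hz.le,
      ← e0, ← e1, ← e2, ← e3]
  rw [w1, w2, w3]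
  nlinarith [mul_le_mul_of_nonneg_left key (mul_pos hyp hyp).le]

end

/-! ### The kernels of the integral averaged formula -/

section

variable {β : ℝ}

/-- As `β - 1 > -1` the singularity is integrable, so no condition on the position of `x` is needed.
-/
theorem integral_omega_sub (hβ0 : 0 < β) (x c d : ℝ) :
    ∫ s in c..d, omega β (x - s)
      = ((x - c) ^ β - (x - d) ^ β) / (Real.Gamma β * β) := by
  rw [intervalIntegral.integral_comp_sub_left (fun u => omega β u) x]
  simp only [omega]
  rw [intervalIntegral.integral_div, integral_rpow (Or.inl (by linarith)), sub_add_cancel,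
    div_div, mul_comm β]

theorem intervalIntegrable_sub_rpow (hβ0 : 0 < β) (a b c : ℝ) :
    IntervalIntegrable (fun x : ℝ => (x - c) ^ β) MeasureTheory.volume a b :=
  ((continuous_id.sub continuous_const).rpow_const fun _ => Or.inr hβ0.le).intervalIntegrable _ _

theorem integral_sub_rpow (hβ0 : 0 < β) (a b c : ℝ) :
    ∫ x in a..b, (x - c) ^ β = ((b - c) ^ (1 + β) - (a - c) ^ (1 + β)) / (1 + β) := by
  rw [intervalIntegral.integral_comp_sub_right (fun u => u ^ β) c,
    integral_rpow (Or.inl (by linarith)), add_comm β]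

theorem kernel_of_lt (hβ0 : 0 < β)
    {t : ℕ → ℝ} {n k : ℕ} (h1 : t k ≤ t (n - 1)) (h2 : t (n - 1) ≤ t n) :
    kernel β t n k = 1 / (Real.Gamma β * β * (1 + β)) / (step t n * step t k)
      * mixedDiff β (t (n - 1)) (t n) (t (k - 1)) (t k) := by
  have hi : ∀ x ∈ Set.uIcc (t (n - 1)) (t n),
      ∫ s in (t (k - 1))..(min x (t k)), omega β (x - s)
        = ((x - t (k - 1)) ^ β - (x - t k) ^ β) / (Real.Gamma β * β) := by
    intro x hx
    rw [Set.uIcc_of_le h2] at hx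
    rw [min_eq_right (h1.trans hx.1), integral_omega_sub hβ0]
  rw [kernel, intervalIntegral.integral_congr hi, intervalIntegral.integral_div,
    intervalIntegral.integral_sub (intervalIntegrable_sub_rpow hβ0 _ _ _)
      (intervalIntegrable_sub_rpow hβ0 _ _ _), integral_sub_rpow hβ0, integral_sub_rpow hβ0,
    mixedDiff]
  have := (Real.Gamma_pos_of_pos hβ0).ne'
  have : 1 + β ≠ 0 := by linarith
  field_simp
  ring

theorem kernel_self (hβ0 : 0 < β) {t : ℕ → ℝ} {n : ℕ} (h : t (n - 1) ≤ t n) :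
    kernel β t n n = 1 / (Real.Gamma β * β * (1 + β)) / (step t n * step t n)
      * step t n ^ (1 + β) := by
  have hi : ∀ x ∈ Set.uIcc (t (n - 1)) (t n),
      ∫ s in (t (n - 1))..(min x (t n)), omega β (x - s)
        = (x - t (n - 1)) ^ β / (Real.Gamma β * β) := by
    intro x hx
    rw [Set.uIcc_of_le h] at hx
    rw [min_eq_left hx.2, integral_omega_sub hβ0, sub_self, Real.zero_rpow hβ0.ne', sub_zero]
  rw [kernel, intervalIntegral.integral_congr hi, intervalIntegral.integral_div,
    integral_sub_rpow hβ0, sub_self, Real.zero_rpow (by linarith), sub_zero, ← step]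
  have := (Real.Gamma_pos_of_pos hβ0).ne'
  have : 1 + β ≠ 0 := by linarith
  field_simp

theorem modified_kernel_self (hβ0 : 0 < β) {t : ℕ → ℝ} {n : ℕ} (h : t n < t (n + 1)) :
    modified (kernel β t) (n + 1) (n + 1)
      = 1 / (Real.Gamma β * β * (1 + β)) / ((t (n + 1) - t n) * (t (n + 1) - t n))
        * (2 * (t (n + 1) - t n) ^ (1 + β)) := by
  rw [modified_self, kernel_self hβ0 (by simpa using h.le), step, Nat.add_sub_cancel]
  ring

theorem modified_kernel_of_lt (hβ0 : 0 < β)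
    {t : ℕ → ℝ} {n k : ℕ} (hkn : k < n) (h1 : t (k + 1) ≤ t n)
    (h2 : t n < t (n + 1)) :
    modified (kernel β t) (n + 1) (k + 1)
      = 1 / (Real.Gamma β * β * (1 + β)) / ((t (n + 1) - t n) * (t (k + 1) - t k))
        * mixedDiff β (t n) (t (n + 1)) (t k) (t (k + 1)) := by
  rw [modified_of_lt (by omega), kernel_of_lt hβ0 (by simpa using h1) (by simpa using h2.le), step,
    step, Nat.add_sub_cancel, Nat.add_sub_cancel]

theorem mixedDiff_adjacent (hβ0 : 0 < β) (a b c : ℝ) :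
    mixedDiff β b c a b = (c - a) ^ (1 + β) - (b - a) ^ (1 + β) - (c - b) ^ (1 + β) := by
  rw [mixedDiff, sub_self, Real.zero_rpow (by linarith), add_zero]

/-- Row and column comparisons are comparisons of averages. In the cross inequality both sides carry
the same product of step sizes, leaving mixed differences alone. In each of these three, the first
case of the split meets the diagonal. -/
theorem isGradientKernel_modified_kernel (hβ0 : 0 < β) (hβ1 : β < 1) {N : ℕ} {t : ℕ → ℝ}
    (ht : ∀ k < N, t k < t (k + 1))
    (hr : ∀ k : ℕ, 2 ≤ k → k + 1 ≤ N → rStar β (ratio t k) ≤ ratio t (k + 1)) :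
    IsGradientKernel (modified (kernel β t)) N := by
  have hmono : ∀ i j, i ≤ j → j ≤ N → t i ≤ t j := by
    intro i j hij
    induction j, hij using Nat.le_induction with
    | base => intro _; exact le_rfl
    | succ j _ ih => intro hj; exact (ih (by omega)).trans (ht j (by omega)).le
  have hC : 0 < 1 / (Real.Gamma β * β * (1 + β)) := by
    have := Real.Gamma_pos_of_pos hβ0
    positivity
  obtain ⟨C, hCdef⟩ : ∃ C, C = 1 / (Real.Gamma β * β * (1 + β)) := ⟨_, rfl⟩
  rw [← hCdef] at hC
  refine ⟨?_, ?_, ?_, ?_⟩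
  · intro j k hk hkj hj
    obtain ⟨k, rfl⟩ := Nat.exists_eq_add_of_le' hk
    obtain ⟨j, rfl⟩ := Nat.exists_eq_add_of_le' (hk.trans hkj)
    have s1 := sub_pos.2 (ht j (by omega))
    have s2 := sub_pos.2 (ht k (by omega))
    rcases eq_or_lt_of_le hkj with h | h
    · obtain rfl : k = j := by omega
      rw [modified_kernel_self hβ0 (ht k (by omega)), ← hCdef]
      have := Real.rpow_pos_of_pos s1 (1 + β)
      positivity
    · have hm := hmono (k + 1) j (by omega) (by omega)
      rw [modified_kernel_of_lt hβ0 (by omega) hm (ht j (by omega)), ← hCdef]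
      have := mixedDiff_pos hβ0 (ht k (by omega)) hm (ht j (by omega))
      positivity
  · intro j k hk hkj hj
    obtain ⟨k, rfl⟩ := Nat.exists_eq_add_of_le' hk
    obtain ⟨j, rfl⟩ := Nat.exists_eq_add_of_le' (hk.trans hkj)
    have s1 := sub_pos.2 (ht j (by omega))
    have s2 := sub_pos.2 (ht k (by omega))
    have s3 := sub_pos.2 (ht (j + 1) (by omega))
    rw [modified_kernel_of_lt hβ0 (by omega) (hmono _ _ (by omega) (by omega))
      (ht (j + 1) (by omega)), ← hCdef, div_mul_eq_mul_div]
    rcases eq_or_lt_of_le hkj with h | h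
    · obtain rfl : k = j := by omega
      rw [modified_kernel_self hβ0 (ht k (by omega)), ← hCdef, div_mul_eq_mul_div,
        div_lt_div_iff₀ (by positivity) (by positivity), mixedDiff_adjacent hβ0]
      have hb := add_rpow_sub_lt hβ0 hβ1 s3 s2
      rw [sub_add_sub_cancel] at hb
      rw [Real.rpow_add s2, Real.rpow_one] at hb ⊢
      have := mul_lt_mul_of_pos_left hb (mul_pos hC (mul_pos s2 s2))
      nlinarith
    · have hm := hmono (k + 1) j (by omega) (by omega)
      rw [modified_kernel_of_lt hβ0 (by omega) hm (ht j (by omega)), ← hCdef, div_mul_eq_mul_div,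
        div_lt_div_iff₀ (by positivity) (by positivity)]
      have := mul_lt_mul_of_pos_left (mixedDiff_slope hβ0 hβ1 (ht k (by omega)) hm
        (ht j (by omega)) (ht (j + 1) (by omega))) (mul_pos hC s2)
      nlinarith
  · intro j k hk hkj hj
    obtain ⟨k, rfl⟩ := Nat.exists_eq_add_of_le' hk
    obtain ⟨j, rfl⟩ := Nat.exists_eq_add_of_le' (show 1 ≤ j by omega)
    have s1 := sub_pos.2 (ht j (by omega))
    have s2 := sub_pos.2 (ht k (by omega))
    have s3 := sub_pos.2 (ht (k + 1) (by omega))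
    rw [modified_kernel_of_lt hβ0 (by omega) (hmono _ _ (by omega) (by omega))
      (ht j (by omega)), ← hCdef, div_mul_eq_mul_div]
    rcases eq_or_lt_of_le hkj with h | h
    · obtain rfl : j = k + 1 := by omega
      rw [modified_kernel_self hβ0 (ht (k + 1) (by omega)), ← hCdef, div_mul_eq_mul_div,
        div_lt_div_iff₀ (by positivity) (by positivity), mixedDiff_adjacent hβ0]
      have hb := add_rpow_sub_lt hβ0 hβ1 s2 s3
      rw [add_comm, sub_add_sub_cancel] at hb
      rw [Real.rpow_add s3, Real.rpow_one] at hb ⊢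
      have := mul_lt_mul_of_pos_left hb (mul_pos hC (mul_pos s3 s3))
      nlinarith
    · have hm := hmono (k + 1 + 1) j (by omega) (by omega)
      rw [modified_kernel_of_lt hβ0 (by omega) hm (ht j (by omega)), ← hCdef, div_mul_eq_mul_div,
        div_lt_div_iff₀ (by positivity) (by positivity)]
      have := mul_lt_mul_of_pos_left (mixedDiff_slope_left hβ0 hβ1 (ht k (by omega))
        (ht (k + 1) (by omega)) hm (ht j (by omega))) (mul_pos hC s1)
      nlinarith
  · intro j k hk hkj hj
    obtain ⟨k, rfl⟩ := Nat.exists_eq_add_of_le' hk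
    obtain ⟨j, rfl⟩ := Nat.exists_eq_add_of_le' (show 1 ≤ j by omega)
    have s1 := sub_pos.2 (ht j (by omega))
    have s2 := sub_pos.2 (ht k (by omega))
    have s3 := sub_pos.2 (ht (k + 1) (by omega))
    have s4 := sub_pos.2 (ht (j + 1) (by omega))
    rw [modified_kernel_of_lt hβ0 (show k < j by omega) (hmono _ _ (by omega) (by omega))
      (ht j (by omega)), modified_kernel_of_lt hβ0 (show k + 1 < j + 1 by omega)
      (hmono _ _ (by omega) (by omega)) (ht (j + 1) (by omega)),
      modified_kernel_of_lt hβ0 (show k < j + 1 by omega) (hmono _ _ (by omega) (by omega))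
      (ht (j + 1) (by omega)), ← hCdef]
    rcases eq_or_lt_of_le hkj with h | h
    · obtain rfl : j = k + 1 := by omega
      rw [modified_kernel_self hβ0 (ht (k + 1) (by omega)), ← hCdef]
      -- The only use of the step ratio condition: three consecutive intervals from `t k` to `t (k +
      -- 3)`, with the middle one giving the diagonal entry.
      have hr' := hr (k + 2) (by omega) (by omega)
      simp only [ratio, step, show k + 2 - 1 = k + 1 by omega, show k + 1 - 1 = k by omega,
        show k + 2 + 1 - 1 = k + 2 by omega] at hr'
      have key := mixedDiff_cross_adjacent hβ0 hβ1 (ht k (by omega)) (ht (k + 1) (by omega))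
        (ht (k + 1 + 1) (by omega)) hr'
      calc _ = C / ((t (k + 1 + 1) - t (k + 1)) * (t (k + 1) - t k))
            * (C / ((t (k + 1 + 1 + 1) - t (k + 1 + 1)) * (t (k + 1 + 1) - t (k + 1))))
            * (mixedDiff β (t (k + 1)) (t (k + 1 + 1)) (t k) (t (k + 1))
              * mixedDiff β (t (k + 1 + 1)) (t (k + 1 + 1 + 1)) (t (k + 1)) (t (k + 1 + 1))) := by
            ring
        _ ≤ _ := mul_le_mul_of_nonneg_left key (by positivity)
        _ = _ := by field_simp
    · have hm := hmono (k + 1 + 1) j (by omega) (by omega)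
      rw [modified_kernel_of_lt hβ0 (by omega) hm (ht j (by omega)), ← hCdef]
      have key := mixedDiff_cross hβ0 hβ1 (ht k (by omega)) (ht (k + 1) (by omega)) hm
        (ht j (by omega)) (ht (j + 1) (by omega))
      calc _ = C / ((t (j + 1) - t j) * (t (k + 1) - t k))
            * (C / ((t (j + 1 + 1) - t (j + 1)) * (t (k + 1 + 1) - t (k + 1))))
            * (mixedDiff β (t j) (t (j + 1)) (t k) (t (k + 1))
              * mixedDiff β (t (j + 1)) (t (j + 1 + 1)) (t (k + 1)) (t (k + 1 + 1))) := by
            ring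
        _ ≤ _ := mul_le_mul_of_nonneg_left key (by positivity)
        _ = _ := by field_simp

end

end IAF

end

theorem mainTheorem2 (β : ℝ) (hβ0 : 0 < β) (hβ1 : β < 1)
    (N : ℕ) (t : ℕ → ℝ) (ht0 : t 0 = 0) (ht : ∀ k < N, t k < t (k + 1))
    (hr : ∀ k : ℕ, 2 ≤ k → k + 1 ≤ N →
      IAF.rStar β (IAF.ratio t k) ≤ IAF.ratio t (k + 1)) :
    -- the complementary kernels of the modified kernels are positive
    (∀ n k : ℕ, 1 ≤ k → k ≤ n → n ≤ N →
      0 < IAF.dcc (IAF.modified (IAF.kernel β t)) n k ∧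
      0 < IAF.rcc (IAF.modified (IAF.kernel β t)) n k) ∧
    -- the discrete gradient structure equality
    (∀ (w : ℕ → ℝ) (n : ℕ), 1 ≤ n → n ≤ N → IAF.DGSEquality (IAF.kernel β t) w n) ∧
    -- positive definiteness
    (∀ (w : ℕ → ℝ) (n : ℕ), 1 ≤ n → n ≤ N → (∃ k, 1 ≤ k ∧ k ≤ n ∧ w k ≠ 0) →
      2 * ∑ k ∈ Finset.Icc 1 n, w k * ∑ j ∈ Finset.Icc 1 k, IAF.kernel β t k j * w j ≥
        ∑ k ∈ Finset.Icc 1 n, IAF.dcc (IAF.modified (IAF.kernel β t)) n k *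
          IAF.conv (IAF.modified (IAF.kernel β t)) w k ^ 2 ∧
      ∑ k ∈ Finset.Icc 1 n, IAF.dcc (IAF.modified (IAF.kernel β t)) n k *
          IAF.conv (IAF.modified (IAF.kernel β t)) w k ^ 2 > 0) := by
  have h := IAF.isGradientKernel_modified_kernel hβ0 hβ1 ht hr
  exact ⟨fun n k hk hkn hn => ⟨h.dcc_pos hk hkn hn, h.rcc_pos hk hkn hn⟩,
    fun w n hn hnN => h.dgsEquality hn hnN w,
    fun w n _ hnN hw => ⟨h.sum_dcc_mul_sq_le hnN w, h.sum_dcc_mul_sq_pos hnN w hw⟩⟩
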